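/- Let $\Gamma$ be a finite connected simplicial graph with vertex set $V$, and let $A_\Gamma$ be the associated right-angled Artin group, with generating set $V$ and relations $ab=ba$ for adjacent $a,b$. For a set $\Theta\subseteq V$ let $A_\Theta$ be the subgroup of $A_\Gamma$ generated by $\Theta$. Let $lk(v)$ be the set of vertices adjacent to $v$ and $st(v)=lk(v)\cup\{v\}$. Write $v\le w$ if $lk(v)\subseteq st(w)$, let $v\sim w$ mean $v\le w$ and $w\le v$, and let $[v]$ be the $\sim$-class of $v$; the class $[v]$ is maximal if $v\le w$ implies $w\le v$ for all $w\in V$. Put $L_{[v]}=lk(v)\setminus[v]$ and $J_{[v]}=L_{[v]}\cup[v]$; then $A_{[v]}$ is normal in $A_{J_{[v]}}$, and the inclusion $A_{L_{[v]}}\to A_{J_{[v]}}$ induces an isomorphism $A_{L_{[v]}}\cong A_{J_{[v]}}/A_{[v]}$. Let $Aut^0(A_\Gamma)\le Aut(A_\Gamma)$ be the subgroup generated by the inner automorphisms, the inversions ($v\mapsto v^{-1}$), the partial conjugations (conjugating all generators in one connected component of $\Gamma-st(w)$ by $w$) and the transvections ($u\mapsto uw$ with $u\le w$, $u\ne w$),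 where each of the last three kinds fixes the remaining generators, and let $Out^0(A_\Gamma)$ be its image in $Out(A_\Gamma)=Aut(A_\Gamma)/Inn(A_\Gamma)$. An automorphism $f$ preserves a subgroup $H$ if $f(H)=H$. **Corollary.** Let $[v]$ be a maximal equivalence class. Every element of $Out^0(A_\Gamma)$ has a representative in $Aut^0(A_\Gamma)$ that preserves both $A_{J_{[v]}}$ and $A_{[v]}$, and there are well-defined homomorphisms $$R_{[v]}: Out^0(A_\Gamma)\to Out(A_{J_{[v]}}),\qquad P_{[v]}: Out^0(A_\Gamma)\to Out(A_{L_{[v]}})$$ as follows. 1. There is a unique homomorphism $R_{[v]}$ that sends the class of $f$ to the class of the restriction $f|_{A_{J_{[v]}}}$, for every $f\in Aut^0(A_\Gamma)$ that preserves $A_{J_{[v]}}$. 2. There is a unique homomorphism $P_{[v]}$ that sends the class of $f$ to the class of the automorphism of $A_{L_{[v]}}\cong A_{J_{[v]}}/A_{[v]}$ induced by $f$, for every $f\in Aut^0(A_\Gamma)$ that preserves both $A_{J_{[v]}}$ and $A_{[v]}$. -/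

import Mathlib

/-- The inner automorphisms form a normal subgroup of the automorphism group. -/
instance innNormal (G : Type*) [Group G] : (MulAut.conj : G →* MulAut G).range.Normal where
  conj_mem := by
    rintro _ ⟨g, rfl⟩ f
    refine ⟨f g, ?_⟩
    ext x
    simp [MulAut.mul_apply]

/-- The outer automorphism group `Out(G) = Aut(G) / Inn(G)`. -/
abbrev Out (G : Type*) [Group G] : Type _ :=
  MulAut G ⧸ (MulAut.conj : G →* MulAut G).range

/-- The outer class of an automorphism. -/
abbrev outMk (G : Type*) [Group G] : MulAut G →* Out G :=
  QuotientGroup.mk' (MulAut.conj : G →* MulAut G).range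

/-- The automorphism `f` preserves the subgroup `H`, i.e. `f(H) = H`. -/
def Preserves {G : Type*} [Group G] (f : MulAut G) (H : Subgroup G) : Prop :=
  H.map (f : G →* G) = H

/-- The automorphism of `H` obtained by restricting an automorphism that preserves `H`. -/
def restrictAut {G : Type*} [Group G] (f : MulAut G) (H : Subgroup G) (h : Preserves f H) :
    MulAut H :=
  (f.subgroupMap H).trans (MulEquiv.subgroupCongr h)

theorem restrictAut_apply {G : Type*} [Group G] (f : MulAut G) (H : Subgroup G)
    (h : Preserves f H) (x : H) : (restrictAut f H h x : G) = f x := rfl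

namespace RAAG

/-- The right-angled Artin group `A_Γ`: generators are the vertices, relators are the commutators
of adjacent vertices. -/
abbrev Grp {V : Type*} (Γ : SimpleGraph V) : Type _ :=
  PresentedGroup {r : FreeGroup V | ∃ a b, Γ.Adj a b ∧
    r = FreeGroup.of a * FreeGroup.of b * (FreeGroup.of a)⁻¹ * (FreeGroup.of b)⁻¹}

/-- The standard generator of `A_Γ` given by a vertex. -/
def gen {V : Type*} (Γ : SimpleGraph V) (v : V) : Grp Γ := PresentedGroup.of v

/-- The link of `v`: the vertices at distance one from `v`. -/
def lk {V : Type*} (Γ : SimpleGraph V) (v : V) : Set V := Γ.neighborSet v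

/-- The star of `v`: the vertices at distance at most one from `v`. -/
def st {V : Type*} (Γ : SimpleGraph V) (v : V) : Set V := insert v (lk Γ v)

/-- The relation `v ≤ w` on vertices: `lk(v) ⊆ st(w)`. -/
def VLe {V : Type*} (Γ : SimpleGraph V) (v w : V) : Prop := lk Γ v ⊆ st Γ w

/-- The equivalence class `[v]` for the relation `v ≤ w ∧ w ≤ v`. -/
def cls {V : Type*} (Γ : SimpleGraph V) (v : V) : Set V := {w | VLe Γ v w ∧ VLe Γ w v}

/-- The class `[v]` is maximal for the partial order induced by `≤` on equivalence classes. -/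
def IsMaximalClass {V : Type*} (Γ : SimpleGraph V) (v : V) : Prop :=
  ∀ w, VLe Γ v w → VLe Γ w v

/-- `L_[v] = lk(v) \ [v]`. -/
def linkSet {V : Type*} (Γ : SimpleGraph V) (v : V) : Set V := lk Γ v \ cls Γ v

/-- The vertex set of the join `J_[v] = L_[v] * [v]`. -/
def joinSet {V : Type*} (Γ : SimpleGraph V) (v : V) : Set V := linkSet Γ v ∪ cls Γ v

theorem vle_refl {V : Type*} (Γ : SimpleGraph V) (v : V) : VLe Γ v v :=
  Set.subset_insert _ _

theorem vle_trans {V : Type*} (Γ : SimpleGraph V) {u v w : V} (h₁ : VLe Γ u v) (h₂ : VLe Γ v w) :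
    VLe Γ u w := by
  intro x hx
  rcases h₁ hx with rfl | h
  · have hux : Γ.Adj u x := hx
    rcases h₂ (show u ∈ lk Γ x from hux.symm) with h | h
    · subst h
      exact Or.inr hux
    · have hwu : Γ.Adj w u := h
      rcases h₁ (show w ∈ lk Γ u from hwu.symm) with h' | h'
      · exact Or.inl h'.symm
      · exact Or.inr (show Γ.Adj w x from (show Γ.Adj x w from h').symm)
  · exact h₂ h

/-- `[v]` depends only on the class of `v`. -/
theorem cls_congr {V : Type*} (Γ : SimpleGraph V) {v w : V} (h : w ∈ cls Γ v) :
    cls Γ w = cls Γ v := by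
  ext x
  exact ⟨fun k => ⟨vle_trans Γ h.1 k.1, vle_trans Γ k.2 h.2⟩,
    fun k => ⟨vle_trans Γ h.2 k.1, vle_trans Γ k.2 h.1⟩⟩

/-- Every vertex of `L_[v]` is adjacent to every vertex of `[v]`. -/
theorem adj_of_mem {V : Type*} (Γ : SimpleGraph V) {v a b : V} (ha : a ∈ linkSet Γ v)
    (hb : b ∈ cls Γ v) : Γ.Adj a b := by
  rcases hb.1 ha.1 with rfl | h
  · exact absurd hb ha.2
  · exact (show Γ.Adj b a from h).symm

/-- `L_[v]` depends only on the class of `v`. -/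
theorem linkSet_congr {V : Type*} (Γ : SimpleGraph V) {v w : V} (h : w ∈ cls Γ v) :
    linkSet Γ w = linkSet Γ v := by
  have hv : v ∈ cls Γ w := ⟨h.2, h.1⟩
  ext x
  exact ⟨fun k => ⟨(adj_of_mem Γ k hv).symm, cls_congr Γ h ▸ k.2⟩,
    fun k => ⟨(adj_of_mem Γ k h).symm, (cls_congr Γ h).symm ▸ k.2⟩⟩

/-- The special subgroup `A_Θ` of `A_Γ` generated by a set `Θ` of vertices. -/
def special {V : Type*} (Γ : SimpleGraph V) (Θ : Set V) : Subgroup (Grp Γ) :=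
  Subgroup.closure (gen Γ '' Θ)

/-- `A_[v]`. -/
abbrev clsGrp {V : Type*} (Γ : SimpleGraph V) (v : V) : Subgroup (Grp Γ) := special Γ (cls Γ v)

/-- `A_{L_[v]}`. -/
abbrev linkGrp {V : Type*} (Γ : SimpleGraph V) (v : V) : Subgroup (Grp Γ) :=
  special Γ (linkSet Γ v)

/-- `A_{J_[v]}`. -/
abbrev joinGrp {V : Type*} (Γ : SimpleGraph V) (v : V) : Subgroup (Grp Γ) :=
  special Γ (joinSet Γ v)

/-- An inversion: one standard generator is inverted, the others are fixed. -/
def IsInversion {V : Type*} (Γ : SimpleGraph V) (f : MulAut (Grp Γ)) : Prop :=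
  ∃ v : V, f (gen Γ v) = (gen Γ v)⁻¹ ∧ ∀ x, x ≠ v → f (gen Γ x) = gen Γ x

/-- A transvection `u ↦ u w`, where `u ≤ w` and `u ≠ w`. -/
def IsTransvection {V : Type*} (Γ : SimpleGraph V) (f : MulAut (Grp Γ)) : Prop :=
  ∃ u w : V, u ≠ w ∧ VLe Γ u w ∧ f (gen Γ u) = gen Γ u * gen Γ w ∧
    ∀ x, x ≠ u → f (gen Γ x) = gen Γ x

/-- A partial conjugation: all generators in one connected component of `Γ - st(w)` are conjugated
by `w`, the others are fixed. (If there is only one component, this is an inner automorphism.) -/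
def IsPartialConj {V : Type*} (Γ : SimpleGraph V) (f : MulAut (Grp Γ)) : Prop :=
  ∃ (w : V) (C : (Γ.induce (st Γ w)ᶜ).ConnectedComponent),
    (∀ x ∈ Subtype.val '' C.supp, f (gen Γ x) = gen Γ w * gen Γ x * (gen Γ w)⁻¹) ∧
    (∀ x ∉ Subtype.val '' C.supp, f (gen Γ x) = gen Γ x)

/-- The pure automorphism group `Aut⁰(A_Γ)`, generated by inner automorphisms, inversions,
partial conjugations and transvections. -/
def Aut0 {V : Type*} (Γ : SimpleGraph V) : Subgroup (MulAut (Grp Γ)) :=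
  Subgroup.closure {f | f ∈ (MulAut.conj : Grp Γ →* MulAut (Grp Γ)).range ∨ IsInversion Γ f ∨
    IsPartialConj Γ f ∨ IsTransvection Γ f}

/-- The pure outer automorphism group `Out⁰(A_Γ)`, the image of `Aut⁰(A_Γ)` in `Out(A_Γ)`. -/
def Out0 {V : Type*} (Γ : SimpleGraph V) : Subgroup (Out (Grp Γ)) :=
  (Aut0 Γ).map (outMk (Grp Γ))

/-- The canonical map `Aut⁰(A_Γ) → Out⁰(A_Γ)`. -/
def toOut0 {V : Type*} (Γ : SimpleGraph V) : Aut0 Γ →* Out0 Γ :=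
  (outMk (Grp Γ)).subgroupMap (Aut0 Γ)

theorem gen_comm {V : Type*} (Γ : SimpleGraph V) {a b : V} (h : Γ.Adj a b) :
    gen Γ a * gen Γ b = gen Γ b * gen Γ a := by
  have key := PresentedGroup.one_of_mem
    (rels := {r : FreeGroup V | ∃ a b, Γ.Adj a b ∧
      r = FreeGroup.of a * FreeGroup.of b * (FreeGroup.of a)⁻¹ * (FreeGroup.of b)⁻¹})
    (x := FreeGroup.of a * FreeGroup.of b * (FreeGroup.of a)⁻¹ * (FreeGroup.of b)⁻¹)
    ⟨a, b, h, rfl⟩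
  simp only [map_mul, map_inv] at key
  exact mul_inv_eq_iff_eq_mul.mp (mul_inv_eq_one.mp key)

open Classical in
/-- The retraction of `A_Γ` onto `A_Θ` killing the generators outside `Θ`. -/
noncomputable def retr {V : Type*} (Γ : SimpleGraph V) (Θ : Set V) : Grp Γ →* Grp Γ :=
  PresentedGroup.toGroup (f := fun x => if x ∈ Θ then gen Γ x else 1) (by
    rintro _ ⟨a, b, h, rfl⟩
    simp only [map_mul, map_inv, FreeGroup.lift_apply_of, mul_inv_eq_iff_eq_mul]
    by_cases ha : a ∈ Θ <;> by_cases hb : b ∈ Θ <;> simp [ha, hb, gen_comm Γ h])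

open Classical in
theorem retr_gen {V : Type*} (Γ : SimpleGraph V) (Θ : Set V) (x : V) :
    retr Γ Θ (gen Γ x) = if x ∈ Θ then gen Γ x else 1 :=
  PresentedGroup.toGroup.of _

theorem retr_of_mem {V : Type*} (Γ : SimpleGraph V) (Θ : Set V) {x : Grp Γ}
    (hx : x ∈ special Γ Θ) : retr Γ Θ x = x := by
  have : Set.EqOn (retr Γ Θ) (MonoidHom.id _) (gen Γ '' Θ) := by
    rintro _ ⟨y, hy, rfl⟩
    simp [retr_gen, hy]
  exact MonoidHom.eqOn_closure this hx

theorem retr_of_disjoint {V : Type*} (Γ : SimpleGraph V) {Θ Ψ : Set V} (h : Disjoint Θ Ψ)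
    {x : Grp Γ} (hx : x ∈ special Γ Ψ) : retr Γ Θ x = 1 := by
  have : Set.EqOn (retr Γ Θ) (1 : Grp Γ →* Grp Γ) (gen Γ '' Ψ) := by
    rintro _ ⟨y, hy, rfl⟩
    simp [retr_gen, Set.disjoint_right.mp h hy]
  exact MonoidHom.eqOn_closure this hx

/-- The canonical map from the right-angled Artin group of the subgraph spanned by `Θ`. -/
def inducedHom {V : Type*} (Γ : SimpleGraph V) (Θ : Set V) : Grp (Γ.induce Θ) →* Grp Γ :=
  PresentedGroup.toGroup (f := fun x : Θ => gen Γ x) (by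
    rintro _ ⟨a, b, h, rfl⟩
    simp only [map_mul, map_inv, FreeGroup.lift_apply_of, mul_inv_eq_iff_eq_mul]
    exact gen_comm Γ h)

open Classical in
/-- The canonical map onto the right-angled Artin group of the subgraph spanned by `Θ`. -/
noncomputable def inducedRetr {V : Type*} (Γ : SimpleGraph V) (Θ : Set V) :
    Grp Γ →* Grp (Γ.induce Θ) :=
  PresentedGroup.toGroup (f := fun x => if h : x ∈ Θ then gen (Γ.induce Θ) ⟨x, h⟩ else 1) (by
    rintro _ ⟨a, b, h, rfl⟩
    simp only [map_mul, map_inv, FreeGroup.lift_apply_of, mul_inv_eq_iff_eq_mul]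
    by_cases ha : a ∈ Θ <;> by_cases hb : b ∈ Θ <;> simp [ha, hb]
    exact gen_comm (Γ.induce Θ) (a := ⟨a, ha⟩) (b := ⟨b, hb⟩) h)

/-- The special subgroup `A_Θ` is (canonically isomorphic to) the right-angled Artin group of the
subgraph spanned by `Θ`. -/
theorem inducedHom_injective_range {V : Type*} (Γ : SimpleGraph V) (Θ : Set V) :
    Function.Injective (inducedHom Γ Θ) ∧ (inducedHom Γ Θ).range = special Γ Θ := by
  have hg : ∀ x : Θ, inducedHom Γ Θ (gen (Γ.induce Θ) x) = gen Γ x :=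
    fun x => PresentedGroup.toGroup.of _
  constructor
  · have : (inducedRetr Γ Θ).comp (inducedHom Γ Θ) = MonoidHom.id _ := by
      refine PresentedGroup.ext fun x => ?_
      have hx : inducedRetr Γ Θ (gen Γ x) = gen (Γ.induce Θ) x :=
        (PresentedGroup.toGroup.of _).trans (dif_pos x.2)
      exact (congrArg (inducedRetr Γ Θ) (hg x)).trans hx
    exact Function.LeftInverse.injective (g := inducedRetr Γ Θ) (DFunLike.congr_fun this)
  · rw [MonoidHom.range_eq_map, ← PresentedGroup.closure_range_of, MonoidHom.map_closure, special]
    congr 1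
    ext y
    constructor
    · rintro ⟨_, ⟨x, rfl⟩, rfl⟩
      exact ⟨x, x.2, (hg x).symm⟩
    · rintro ⟨x, hx, rfl⟩
      exact ⟨_, ⟨⟨x, hx⟩, rfl⟩, hg ⟨x, hx⟩⟩

theorem joinGrp_eq {V : Type*} (Γ : SimpleGraph V) (v : V) :
    joinGrp Γ v = linkGrp Γ v ⊔ clsGrp Γ v := by
  simp only [joinGrp, linkGrp, clsGrp, special, joinSet, Set.image_union, Subgroup.closure_union]

theorem linkGrp_le {V : Type*} (Γ : SimpleGraph V) (v : V) : linkGrp Γ v ≤ joinGrp Γ v :=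
  joinGrp_eq Γ v ▸ le_sup_left

theorem clsGrp_le {V : Type*} (Γ : SimpleGraph V) (v : V) : clsGrp Γ v ≤ joinGrp Γ v :=
  joinGrp_eq Γ v ▸ le_sup_right

/-- The factors `A_{L_[v]}` and `A_[v]` commute. -/
theorem linkGrp_comm {V : Type*} (Γ : SimpleGraph V) (v : V) :
    linkGrp Γ v ≤ Subgroup.centralizer (clsGrp Γ v : Set (Grp Γ)) := by
  rw [clsGrp, special, Subgroup.centralizer_closure]
  refine (Subgroup.closure_le _).mpr ?_
  rintro _ ⟨a, ha, rfl⟩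
  refine Subgroup.mem_centralizer_iff.mpr ?_
  rintro _ ⟨b, hb, rfl⟩
  exact (gen_comm Γ (adj_of_mem Γ ha hb)).symm

/-- `A_[v]` is normal in `A_{J_[v]}`. -/
instance clsGrp_normal {V : Type*} (Γ : SimpleGraph V) (v : V) :
    ((clsGrp Γ v).subgroupOf (joinGrp Γ v)).Normal := by
  rw [Subgroup.normal_subgroupOf_iff_le_normalizer (clsGrp_le Γ v), joinGrp_eq]
  refine sup_le ?_ Subgroup.le_normalizer
  exact (linkGrp_comm Γ v).trans (Subgroup.centralizer_le_normalizer _)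

/-- The quotient `A_{J_[v]} / A_[v]`. -/
abbrev JoinQuot {V : Type*} (Γ : SimpleGraph V) (v : V) : Type _ :=
  joinGrp Γ v ⧸ (clsGrp Γ v).subgroupOf (joinGrp Γ v)

/-- The canonical map `A_{L_[v]} → A_{J_[v]} → A_{J_[v]} / A_[v]`. -/
def linkToQuot {V : Type*} (Γ : SimpleGraph V) (v : V) : linkGrp Γ v →* JoinQuot Γ v :=
  (QuotientGroup.mk' _).comp (Subgroup.inclusion (linkGrp_le Γ v))

theorem linkToQuot_bijective {V : Type*} (Γ : SimpleGraph V) (v : V) :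
    Function.Bijective (linkToQuot Γ v) := by
  constructor
  · refine (injective_iff_map_eq_one _).mpr fun x hx => ?_
    have hx' : (x : Grp Γ) ∈ clsGrp Γ v :=
      
      Subgroup.mem_subgroupOf.mp
        ((QuotientGroup.eq_one_iff (Subgroup.inclusion (linkGrp_le Γ v) x)).mp hx)
    have h₁ := retr_of_mem Γ (linkSet Γ v) x.2
    have h₂ := retr_of_disjoint Γ (Set.disjoint_sdiff_left : Disjoint (linkSet Γ v) (cls Γ v)) hx'
    exact Subtype.ext (h₁.symm.trans h₂)
  · intro q
    obtain ⟨⟨x, hx⟩, rfl⟩ := QuotientGroup.mk_surjective q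
    have hx' : x ∈ linkGrp Γ v ⊔ clsGrp Γ v := joinGrp_eq Γ v ▸ hx
    have hn : linkGrp Γ v ≤ Subgroup.normalizer (clsGrp Γ v : Set (Grp Γ)) :=
      (linkGrp_comm Γ v).trans (Subgroup.centralizer_le_normalizer _)
    rw [← SetLike.mem_coe, Subgroup.coe_mul_of_left_le_normalizer_right _ _ hn] at hx'
    obtain ⟨a, ha, b, hb, rfl⟩ := hx'
    refine ⟨⟨a, ha⟩, ?_⟩
    refine QuotientGroup.eq.mpr (Subgroup.mem_subgroupOf.mpr ?_)
    simpa using hb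

/-- The canonical isomorphism `A_{L_[v]} ≅ A_{J_[v]} / A_[v]`. -/
noncomputable def linkEquivQuot {V : Type*} (Γ : SimpleGraph V) (v : V) :
    linkGrp Γ v ≃* JoinQuot Γ v :=
  MulEquiv.ofBijective (linkToQuot Γ v) (linkToQuot_bijective Γ v)

theorem restrictAut_map {G : Type*} [Group G] (f : MulAut G) {H K : Subgroup G}
    (hH : Preserves f H) (hK : Preserves f K) (hle : K ≤ H) :
    (K.subgroupOf H).map (restrictAut f H hH : H →* H) = K.subgroupOf H := by
  ext ⟨y, hy⟩
  simp only [Subgroup.mem_map, Subgroup.mem_subgroupOf]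
  constructor
  · rintro ⟨x, hx, h⟩
    have hxy : f x = y := congrArg Subtype.val h
    rw [← hxy, ← hK]
    exact ⟨x, hx, rfl⟩
  · intro h
    rw [← hK] at h
    obtain ⟨x, hx, hxy⟩ := h
    exact ⟨⟨x, hle hx⟩, hx, Subtype.ext hxy⟩

/-- The automorphism of `A_{J_[v]} / A_[v]` induced by an automorphism of `A_Γ` that preserves
`A_{J_[v]}` and `A_[v]`. -/
def quotAut {V : Type*} (Γ : SimpleGraph V) (v : V) (f : MulAut (Grp Γ))
    (hJ : Preserves f (joinGrp Γ v)) (hC : Preserves f (clsGrp Γ v)) : MulAut (JoinQuot Γ v) :=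
  QuotientGroup.congr _ _ (restrictAut f (joinGrp Γ v) hJ)
    (restrictAut_map f hJ hC (clsGrp_le Γ v))

/-- The same automorphism, transported to `A_{L_[v]}` along `A_{L_[v]} ≅ A_{J_[v]} / A_[v]`. -/
noncomputable def projAut {V : Type*} (Γ : SimpleGraph V) (v : V) (f : MulAut (Grp Γ))
    (hJ : Preserves f (joinGrp Γ v)) (hC : Preserves f (clsGrp Γ v)) : MulAut (linkGrp Γ v) :=
  MulAut.congr (linkEquivQuot Γ v).symm (quotAut Γ v f hJ hC)

end RAAG

/-! Since inner automorphisms form a normal subgroup, it suffices to correct each generator of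
`Aut0` by an inner automorphism so that it preserves both $A_{J_{[v]}}$ and $A_{[v]}$. Inversions
preserve every special subgroup, and transvections need no correction because $[v]$ and $J_{[v]}$
are upward closed for $\le$. A partial conjugation by $w\in J_{[v]}$ needs none either. If $w\notin
J_{[v]}$, maximality puts $J_{[v]}\setminus st(w)$ in a single component
(`reachable_of_mem_joinSet`), so on $A_{J_{[v]}}$ the map is trivial or conjugation by $w$.

Two representatives of one outer class differ by a conjugation, so well-definedness reduces to the
case of a conjugation by $g$ preserving $A_{J_{[v]}}$. The retraction onto $A_{J_{[v]}}$ shows that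
it acts there as conjugation by the retract of $g$ (`restrictAut_conj`), hence as an inner
automorphism, also on the quotient by $A_{[v]}$. Existence of representatives gives uniqueness of
both homomorphisms. -/

/-- The automorphisms of `G` that preserve the subgroup `H`. -/
def preserving {G : Type*} [Group G] (H : Subgroup G) : Subgroup (MulAut G) where
  carrier := {f | Preserves f H}
  one_mem' := H.map_id
  mul_mem' {f g} hf hg := by
    have : ((f * g : MulAut G) : G →* G) = (f : G →* G).comp (g : G →* G) := rfl
    change H.map _ = H
    rw [this, ← Subgroup.map_map, hg, hf]
  inv_mem' {f} hf := by
    have : ((f⁻¹ : MulAut G) : G →* G).comp (f : G →* G) = MonoidHom.id G :=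
      MonoidHom.ext fun x => f.symm_apply_apply x
    change H.map _ = H
    conv_lhs => rw [← hf]
    rw [Subgroup.map_map, this, Subgroup.map_id]

/-- Restriction to a preserved subgroup, as a homomorphism. -/
def restrictHom {G : Type*} [Group G] (H : Subgroup G) : preserving H →* MulAut H where
  toFun f := restrictAut f.1 H f.2
  map_one' := rfl
  map_mul' _ _ := rfl

/-- A homomorphism defined on a subgroup that surjects onto the quotient, and trivial on the kernel
of the quotient map, descends uniquely. -/
theorem existsUnique_hom_of_subgroup {A Q B : Type*} [Group A] [Group Q] [Group B] (π : A →* Q)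
    (S : Subgroup A) (r : S →* B) (hsurj : ∀ q, ∃ s : S, π s = q)
    (hker : ∀ s : S, π s = 1 → r s = 1) :
    ∃! R : Q →* B, ∀ s : S, R (π s) = r s := by
  have hπ : Function.Surjective (π.comp S.subtype) := hsurj
  refine ⟨(π.comp S.subtype).liftOfSurjective hπ ⟨r, fun s hs => hker s hs⟩, fun s => ?_,
    fun R hR => ?_⟩
  · exact MonoidHom.liftOfRightInverse_comp_apply (π.comp S.subtype) _
      (Function.rightInverse_surjInv hπ) ⟨r, fun s hs => hker s hs⟩ s
  · refine MonoidHom.ext fun q => ?_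
    obtain ⟨s, rfl⟩ := hsurj q
    rw [hR]
    exact (MonoidHom.liftOfRightInverse_comp_apply (π.comp S.subtype) _
      (Function.rightInverse_surjInv hπ) ⟨r, fun s hs => hker s hs⟩ s).symm

theorem outMk_eq_one_iff {G : Type*} [Group G] (f : MulAut G) :
    outMk G f = 1 ↔ ∃ g, f = MulAut.conj g := by
  rw [QuotientGroup.mk'_apply, QuotientGroup.eq_one_iff]
  exact ⟨fun ⟨g, hg⟩ => ⟨g, hg.symm⟩, fun ⟨g, hg⟩ => ⟨g, hg.symm⟩⟩

namespace RAAG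

variable {V : Type*} {Γ : SimpleGraph V}

/-! ### Special subgroups, retractions and conjugations -/

theorem gen_mem_special {Θ : Set V} {x : V} (hx : x ∈ Θ) : gen Γ x ∈ special Γ Θ :=
  Subgroup.subset_closure ⟨x, hx, rfl⟩

theorem retr_mem_special (Θ : Set V) (g : Grp Γ) : retr Γ Θ g ∈ special Γ Θ := by
  have h : (⊤ : Subgroup (Grp Γ)) ≤ (special Γ Θ).comap (retr Γ Θ) := by
    rw [← PresentedGroup.closure_range_of, Subgroup.closure_le]
    rintro _ ⟨x, rfl⟩
    change retr Γ Θ (gen Γ x) ∈ special Γ Θ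
    rw [retr_gen]
    split_ifs with hx
    · exact gen_mem_special hx
    · exact one_mem _
  exact h (Subgroup.mem_top g)

/-- A conjugation that preserves a special subgroup restricts to an inner automorphism of it. -/
theorem restrictAut_conj (Θ : Set V) (g : Grp Γ)
    (h : Preserves (MulAut.conj g) (special Γ Θ)) :
    restrictAut (MulAut.conj g) (special Γ Θ) h =
      MulAut.conj (⟨retr Γ Θ g, retr_mem_special Θ g⟩ : special Γ Θ) := by
  refine MulEquiv.ext fun x => Subtype.ext ?_
  have hx : g * x * g⁻¹ ∈ special Γ Θ := (restrictAut (MulAut.conj g) (special Γ Θ) h x).2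
  -- The retraction fixes both `x` and `g * x * g⁻¹`, so applying it to the latter replaces `g` by
  -- its retract.
  have := retr_of_mem Γ Θ hx
  rw [map_mul, map_mul, map_inv, retr_of_mem Γ Θ x.2] at this
  exact this.symm

theorem preserves_special {f : MulAut (Grp Γ)} {Θ : Set V}
    (h₁ : ∀ x ∈ Θ, f (gen Γ x) ∈ special Γ Θ)
    (h₂ : ∀ x ∈ Θ, ∃ y ∈ special Γ Θ, f y = gen Γ x) : Preserves f (special Γ Θ) := by
  refine le_antisymm ?_ ?_
  · rw [Subgroup.map_le_iff_le_comap]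
    refine (Subgroup.closure_le _).mpr ?_
    rintro _ ⟨x, hx, rfl⟩
    exact h₁ x hx
  · refine (Subgroup.closure_le _).mpr ?_
    rintro _ ⟨x, hx, rfl⟩
    exact h₂ x hx

theorem preserves_special_of_fix {f : MulAut (Grp Γ)} {Θ : Set V}
    (h : ∀ x ∈ Θ, f (gen Γ x) = gen Γ x) : Preserves f (special Γ Θ) :=
  preserves_special (fun x hx => (h x hx).symm ▸ gen_mem_special hx)
    fun x hx => ⟨_, gen_mem_special hx, h x hx⟩

/-! ### Action of the generators of `Aut0` on special subgroups -/

theorem IsInversion.preserves {f : MulAut (Grp Γ)} (hf : IsInversion Γ f) (Θ : Set V) :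
    Preserves f (special Γ Θ) := by
  obtain ⟨u, hu, hfix⟩ := hf
  refine preserves_special (fun x hx => ?_) fun x hx => ?_
  · by_cases hxu : x = u
    · subst hxu
      exact hu ▸ inv_mem (gen_mem_special hx)
    · exact (hfix x hxu).symm ▸ gen_mem_special hx
  · by_cases hxu : x = u
    · subst hxu
      exact ⟨_, inv_mem (gen_mem_special hx), by rw [map_inv, hu, inv_inv]⟩
    · exact ⟨_, gen_mem_special hx, hfix x hxu⟩

/-- A transvection `u ↦ u w` preserves `A_Θ` as soon as `u ∈ Θ` implies `w ∈ Θ`. -/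
theorem preserves_of_transvection {f : MulAut (Grp Γ)} {u w : V} (huw : u ≠ w)
    (hu : f (gen Γ u) = gen Γ u * gen Γ w) (hfix : ∀ x, x ≠ u → f (gen Γ x) = gen Γ x)
    {Θ : Set V} (hΘ : u ∈ Θ → w ∈ Θ) : Preserves f (special Γ Θ) := by
  refine preserves_special (fun x hx => ?_) fun x hx => ?_
  · by_cases hxu : x = u
    · subst hxu
      exact hu ▸ mul_mem (gen_mem_special hx) (gen_mem_special (hΘ hx))
    · exact (hfix x hxu).symm ▸ gen_mem_special hx
  · by_cases hxu : x = u
    · subst hxu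
      exact ⟨gen Γ x * (gen Γ w)⁻¹, mul_mem (gen_mem_special hx)
        (inv_mem (gen_mem_special (hΘ hx))), by
          rw [map_mul, map_inv, hu, hfix w huw.symm, mul_inv_cancel_right]⟩
    · exact ⟨_, gen_mem_special hx, hfix x hxu⟩

/-- An automorphism conjugating by `w` the generators in a set `C` not containing `w`, and fixing
the others, preserves `A_Θ` for `w ∈ Θ`. -/
theorem preserves_of_partialConj {f : MulAut (Grp Γ)} {w : V} {C : Set V} (hwC : w ∉ C)
    (hC : ∀ x ∈ C, f (gen Γ x) = gen Γ w * gen Γ x * (gen Γ w)⁻¹)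
    (hfix : ∀ x ∉ C, f (gen Γ x) = gen Γ x) {Θ : Set V} (hw : w ∈ Θ) :
    Preserves f (special Γ Θ) := by
  have hgw : gen Γ w ∈ special Γ Θ := gen_mem_special hw
  refine preserves_special (fun x hx => ?_) fun x hx => ?_
  · by_cases hxC : x ∈ C
    · exact hC x hxC ▸ mul_mem (mul_mem hgw (gen_mem_special hx)) (inv_mem hgw)
    · exact (hfix x hxC).symm ▸ gen_mem_special hx
  · by_cases hxC : x ∈ C
    · refine ⟨(gen Γ w)⁻¹ * gen Γ x * gen Γ w,
        mul_mem (mul_mem (inv_mem hgw) (gen_mem_special hx)) hgw, ?_⟩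
      -- As `w ∉ C`, the generator of `w` is fixed, so the two conjugations cancel.
      rw [map_mul, map_mul, map_inv, hfix w hwC, hC x hxC]
      group
    · exact ⟨_, gen_mem_special hx, hfix x hxC⟩

theorem mem_joinSet_of_mem_lk {v x : V} (h : x ∈ lk Γ v) : x ∈ joinSet Γ v := by
  by_cases hx : x ∈ cls Γ v
  · exact Or.inr hx
  · exact Or.inl ⟨h, hx⟩

theorem mem_joinSet_self (v : V) : v ∈ joinSet Γ v := Or.inr ⟨vle_refl Γ v, vle_refl Γ v⟩

/-- For a maximal class `[v]` and `w` outside `J_[v]`, the set `J_[v] - st(w)` contains `v` and lies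
in one component of `Γ - st(w)`. -/
theorem reachable_of_mem_joinSet {v w : V} (hv : IsMaximalClass Γ v) (hw : w ∉ joinSet Γ v) :
    ∃ hvw : v ∉ st Γ w, ∀ x ∈ joinSet Γ v, ∀ hx : x ∉ st Γ w,
      (Γ.induce (st Γ w)ᶜ).Reachable ⟨v, hvw⟩ ⟨x, hx⟩ := by
  have hvw : v ∉ st Γ w := by
    rintro (rfl | h)
    · exact hw (mem_joinSet_self v)
    · exact hw (mem_joinSet_of_mem_lk (show Γ.Adj w v from h).symm)
  refine ⟨hvw, fun x hxJ hx => ?_⟩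
  by_cases hxv : x = v
  · subst hxv
    exact SimpleGraph.Reachable.refl _
  by_cases hadj : Γ.Adj v x
  · exact SimpleGraph.Adj.reachable hadj
  rcases hxJ with hxL | hxc
  · exact absurd hxL.1 hadj
  -- Otherwise `v ≤ w`, and maximality would put `w` in `[v]`. Such an `l` is also adjacent to `x`,
  -- because `lk(v) ⊆ st(x)`, and gives a path from `v` to `x` avoiding `st(w)`.
  obtain ⟨l, hl, hlw⟩ : ∃ l ∈ lk Γ v, l ∉ st Γ w := by
    by_contra! h
    exact hw (Or.inr ⟨h, hv w h⟩)
  have hvl : Γ.Adj v l := hl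
  rcases hxc.1 hl with rfl | hxl
  · exact absurd hvl hadj
  have hlx : Γ.Adj l x := (show Γ.Adj x l from hxl).symm
  have h₁ : (Γ.induce (st Γ w)ᶜ).Adj ⟨v, hvw⟩ ⟨l, hlw⟩ := hvl
  have h₂ : (Γ.induce (st Γ w)ᶜ).Adj ⟨l, hlw⟩ ⟨x, hx⟩ := hlx
  exact h₁.reachable.trans h₂.reachable

/-- Maximality makes `[v]` upward closed. For `u ∈ L_[v]`, the inclusion `lk(u) ⊆ st(w)` gives `v ∈
st(w)`, hence `w ∈ J_[v]`. -/
theorem IsTransvection.preserves {v : V} (hv : IsMaximalClass Γ v) {f : MulAut (Grp Γ)}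
    (hf : IsTransvection Γ f) : Preserves f (joinGrp Γ v) ∧ Preserves f (clsGrp Γ v) := by
  obtain ⟨u, w, huw, hle, hu, hfix⟩ := hf
  have hcls : u ∈ cls Γ v → w ∈ cls Γ v := fun h =>
    have hvw := vle_trans Γ h.1 hle
    ⟨hvw, hv w hvw⟩
  refine ⟨preserves_of_transvection huw hu hfix ?_, preserves_of_transvection huw hu hfix hcls⟩
  rintro (h | h)
  · rcases hle (show v ∈ lk Γ u from (show Γ.Adj v u from h.1).symm) with rfl | hwv
    · exact mem_joinSet_self _
    · exact mem_joinSet_of_mem_lk (show Γ.Adj w v from hwv).symm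
  · exact Or.inr (hcls h)

theorem IsPartialConj.exists_conj_mul {v : V} (hv : IsMaximalClass Γ v) {f : MulAut (Grp Γ)}
    (hf : IsPartialConj Γ f) :
    ∃ g : Grp Γ, Preserves (MulAut.conj g * f) (joinGrp Γ v) ∧
      Preserves (MulAut.conj g * f) (clsGrp Γ v) := by
  obtain ⟨w, C, hC, hfix⟩ := hf
  have hst : ∀ x ∈ Subtype.val '' C.supp, x ∉ st Γ w := by
    rintro _ ⟨x, -, rfl⟩
    exact x.2
  have hwC : w ∉ Subtype.val '' C.supp := fun h => hst w h (Or.inl rfl)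
  by_cases hw : w ∈ joinSet Γ v
  · refine ⟨1, ?_⟩
    rw [map_one, one_mul]
    refine ⟨preserves_of_partialConj hwC hC hfix hw, ?_⟩
    rcases hw with hwL | hwc
    -- Here `w ∈ L_[v]`, so `[v] ⊆ st(w)` is disjoint from the component.
    · refine preserves_special_of_fix fun x hx => hfix x fun h => hst x h (Or.inr ?_)
      exact adj_of_mem Γ hwL hx
    · exact preserves_of_partialConj hwC hC hfix hwc
  · obtain ⟨hvw, hreach⟩ := reachable_of_mem_joinSet hv hw
    obtain ⟨g, hg⟩ : ∃ g : Grp Γ,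
        ∀ x ∈ joinSet Γ v, (MulAut.conj g * f) (gen Γ x) = gen Γ x := by
      by_cases hvC : v ∈ Subtype.val '' C.supp
      -- The component of `v` contains all of `J_[v] \ st(w)`, while generators in `st(w)` commute
      -- with `w`; so conjugating by `w⁻¹` undoes `f` on all of `J_[v]`.
      · refine ⟨(gen Γ w)⁻¹, fun x hx => ?_⟩
        rw [MulAut.mul_apply, MulAut.conj_apply, inv_inv]
        by_cases hxw : x ∈ st Γ w
        · rw [hfix x fun h => hst x h hxw]
          rcases hxw with rfl | hxw
          · group
          · rw [mul_assoc, ← gen_comm Γ (show Γ.Adj w x from hxw), inv_mul_cancel_left]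
        · have hxC : x ∈ Subtype.val '' C.supp := by
            obtain ⟨y, hy, rfl⟩ := hvC
            refine ⟨⟨x, hxw⟩, ?_, rfl⟩
            rw [SimpleGraph.ConnectedComponent.mem_supp_iff] at hy ⊢
            exact (SimpleGraph.ConnectedComponent.sound (hreach x hx hxw).symm).trans hy
          rw [hC x hxC]
          group
      -- A component missing `v` misses `J_[v]` altogether.
      · refine ⟨1, fun x hx => ?_⟩
        rw [map_one, one_mul]
        refine hfix x ?_
        rintro ⟨y, hy, rfl⟩
        refine hvC ⟨⟨v, hvw⟩, ?_, rfl⟩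
        rw [SimpleGraph.ConnectedComponent.mem_supp_iff] at hy ⊢
        exact (SimpleGraph.ConnectedComponent.sound (hreach y hx y.2)).trans hy
    exact ⟨g, preserves_special_of_fix hg,
      preserves_special_of_fix fun x hx => hg x (Or.inr hx)⟩

/-! ### Representatives of outer classes -/

/-- Up to inner automorphisms, `Aut⁰(A_Γ)` preserves `A_{J_[v]}` and `A_[v]`. -/
theorem aut0_le {v : V} (hv : IsMaximalClass Γ v) :
    Aut0 Γ ≤ (MulAut.conj : Grp Γ →* MulAut (Grp Γ)).range ⊔
      (preserving (joinGrp Γ v) ⊓ preserving (clsGrp Γ v)) := by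
  refine (Subgroup.closure_le _).mpr ?_
  rintro f (hf | hf | hf | hf)
  · exact Subgroup.mem_sup_left hf
  · exact Subgroup.mem_sup_right ⟨hf.preserves _, hf.preserves _⟩
  · obtain ⟨g, hJ, hC⟩ := hf.exists_conj_mul hv
    have : f = MulAut.conj g⁻¹ * (MulAut.conj g * f) := by rw [map_inv, inv_mul_cancel_left]
    rw [this]
    exact mul_mem (Subgroup.mem_sup_left ⟨_, rfl⟩) (Subgroup.mem_sup_right ⟨hJ, hC⟩)
  · exact Subgroup.mem_sup_right (hf.preserves hv)

theorem exists_representative {v : V} (hv : IsMaximalClass Γ v) (φ : Out0 Γ) :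
    ∃ f : Aut0 Γ, toOut0 Γ f = φ ∧ Preserves (f : MulAut (Grp Γ)) (joinGrp Γ v) ∧
      Preserves (f : MulAut (Grp Γ)) (clsGrp Γ v) := by
  obtain ⟨_, f, hf, rfl⟩ := φ
  obtain ⟨c, ⟨g, rfl⟩, s, hs, rfl⟩ := Subgroup.mem_sup_of_normal_left.mp (aut0_le hv hf)
  have hg : MulAut.conj g ∈ Aut0 Γ := Subgroup.subset_closure (Or.inl ⟨g, rfl⟩)
  -- Conjugations belong to `Aut0`, so the remaining factor `s` does too.
  refine ⟨⟨s, (Subgroup.mul_mem_cancel_left _ hg).mp hf⟩, Subtype.ext ?_, hs.1, hs.2⟩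
  change outMk (Grp Γ) s = outMk (Grp Γ) (MulAut.conj g * s)
  rw [map_mul, (outMk_eq_one_iff _).mpr ⟨g, rfl⟩, one_mul]

theorem exists_conj_of_toOut0_eq_one {f : Aut0 Γ} (h : toOut0 Γ f = 1) :
    ∃ g, (f : MulAut (Grp Γ)) = MulAut.conj g :=
  (outMk_eq_one_iff _).mp (congrArg Subtype.val h)

/-! ### Induced automorphisms of the quotient -/

theorem quotAut_mk (v : V) (f : MulAut (Grp Γ)) (hJ : Preserves f (joinGrp Γ v))
    (hC : Preserves f (clsGrp Γ v)) (x : joinGrp Γ v) :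
    quotAut Γ v f hJ hC (x : JoinQuot Γ v) = (restrictAut f (joinGrp Γ v) hJ x : JoinQuot Γ v) :=
  rfl

/-- The induced automorphism of `A_{L_[v]}`, as a homomorphism. -/
noncomputable def projHom (Γ : SimpleGraph V) (v : V) :
    (preserving (joinGrp Γ v) ⊓ preserving (clsGrp Γ v) : Subgroup (MulAut (Grp Γ))) →*
      MulAut (linkGrp Γ v) where
  toFun f := projAut Γ v f.1 f.2.1 f.2.2
  map_one' := by
    refine (map_eq_one_iff _ (MulAut.congr (linkEquivQuot Γ v).symm).injective).mpr ?_
    refine MulEquiv.ext fun q => ?_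
    obtain ⟨x, rfl⟩ := QuotientGroup.mk_surjective q
    rfl
  map_mul' f g := by
    refine Eq.trans (congrArg (MulAut.congr (linkEquivQuot Γ v).symm) ?_)
      (map_mul (MulAut.congr (linkEquivQuot Γ v).symm) _ _)
    refine MulEquiv.ext fun q => ?_
    obtain ⟨x, rfl⟩ := QuotientGroup.mk_surjective q
    rfl

/-- The restriction to `A_{J_[v]}` is inner by the retract of `g`; its image conjugates the
quotient, and the isomorphism transports this to `A_{L_[v]}`. -/
theorem projAut_conj (v : V) (g : Grp Γ) (hJ : Preserves (MulAut.conj g) (joinGrp Γ v))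
    (hC : Preserves (MulAut.conj g) (clsGrp Γ v)) :
    ∃ a, projAut Γ v (MulAut.conj g) hJ hC = MulAut.conj a := by
  obtain ⟨b, hb⟩ : ∃ b : joinGrp Γ v,
      quotAut Γ v (MulAut.conj g) hJ hC = MulAut.conj (b : JoinQuot Γ v) := by
    refine ⟨⟨retr Γ (joinSet Γ v) g, retr_mem_special _ g⟩, MulEquiv.ext fun q => ?_⟩
    obtain ⟨x, rfl⟩ := QuotientGroup.mk_surjective q
    rw [quotAut_mk, restrictAut_conj]
    rfl
  refine ⟨(linkEquivQuot Γ v).symm (b : JoinQuot Γ v), MulEquiv.ext fun x => ?_⟩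
  change (linkEquivQuot Γ v).symm (quotAut Γ v (MulAut.conj g) hJ hC (linkEquivQuot Γ v x)) = _
  rw [hb, MulAut.conj_apply, MulAut.conj_apply, map_mul, map_mul, map_inv,
    MulEquiv.symm_apply_apply]

end RAAG

theorem mainTheorem5 {V : Type*} [Finite V] (Γ : SimpleGraph V) (hΓ : Γ.Connected) (v : V)
    (hv : RAAG.IsMaximalClass Γ v) :
    (∀ φ : RAAG.Out0 Γ, ∃ f : RAAG.Aut0 Γ, RAAG.toOut0 Γ f = φ ∧
      Preserves (f : MulAut (RAAG.Grp Γ)) (RAAG.joinGrp Γ v) ∧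
      Preserves (f : MulAut (RAAG.Grp Γ)) (RAAG.clsGrp Γ v)) ∧
    (∃! R : RAAG.Out0 Γ →* Out (RAAG.joinGrp Γ v),
      ∀ (f : RAAG.Aut0 Γ) (hJ : Preserves (f : MulAut (RAAG.Grp Γ)) (RAAG.joinGrp Γ v)),
        R (RAAG.toOut0 Γ f) =
          outMk (RAAG.joinGrp Γ v) (restrictAut (f : MulAut (RAAG.Grp Γ)) (RAAG.joinGrp Γ v) hJ)) ∧
    (∃! P : RAAG.Out0 Γ →* Out (RAAG.linkGrp Γ v),
      ∀ (f : RAAG.Aut0 Γ) (hJ : Preserves (f : MulAut (RAAG.Grp Γ)) (RAAG.joinGrp Γ v))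
        (hC : Preserves (f : MulAut (RAAG.Grp Γ)) (RAAG.clsGrp Γ v)),
        P (RAAG.toOut0 Γ f) =
          outMk (RAAG.linkGrp Γ v) (RAAG.projAut Γ v (f : MulAut (RAAG.Grp Γ)) hJ hC)) := by
  have hrep := RAAG.exists_representative hv
  refine ⟨hrep, ?_, ?_⟩
  -- The domain is the full stabiliser of `A_{J_[v]}` in `Aut0`, since `R` must also agree with
  -- restriction for those `f` that do not preserve `A_[v]`.
  · have key := existsUnique_hom_of_subgroup (RAAG.toOut0 Γ)
      ((preserving (RAAG.joinGrp Γ v)).comap (RAAG.Aut0 Γ).subtype)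
      ((outMk _).comp ((restrictHom (RAAG.joinGrp Γ v)).comp
        ((RAAG.Aut0 Γ).subtype.subgroupComap _)))
      (fun φ => let ⟨f, hf, hJ, _⟩ := hrep φ; ⟨⟨f, hJ⟩, hf⟩) (by
        rintro ⟨⟨f, hf⟩, hJ⟩ h
        obtain ⟨g, rfl⟩ := RAAG.exists_conj_of_toOut0_eq_one h
        exact (outMk_eq_one_iff _).mpr ⟨_, RAAG.restrictAut_conj _ g hJ⟩)
    refine (existsUnique_congr fun R => ?_).mp key
    exact ⟨fun h f hJ => h ⟨f, hJ⟩, fun h s => h s.1 s.2⟩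
  · have key := existsUnique_hom_of_subgroup (RAAG.toOut0 Γ)
      ((preserving (RAAG.joinGrp Γ v) ⊓ preserving (RAAG.clsGrp Γ v)).comap
        (RAAG.Aut0 Γ).subtype)
      ((outMk _).comp ((RAAG.projHom Γ v).comp ((RAAG.Aut0 Γ).subtype.subgroupComap _)))
      (fun φ => let ⟨f, hf, hJ, hC⟩ := hrep φ; ⟨⟨f, hJ, hC⟩, hf⟩) (by
        rintro ⟨⟨f, hf⟩, hJ, hC⟩ h
        obtain ⟨g, rfl⟩ := RAAG.exists_conj_of_toOut0_eq_one h
        exact (outMk_eq_one_iff _).mpr (RAAG.projAut_conj v g hJ hC))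
    refine (existsUnique_congr fun P => ?_).mp key
    exact ⟨fun h f hJ hC => h ⟨f, hJ, hC⟩, fun h s => h s.1 s.2.1 s.2.2⟩
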